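/- Let $K$ be a field of characteristic zero (for instance $\mathbb{C}$) and let $n\ge 0$. Let $\mathcal{C}(S_n)$ be the $K$-vector space of $K$-valued class functions on the symmetric group $S_n$, and for each partition $\lambda\vdash n$ let $\chi^\lambda\in\mathcal{C}(S_n)$ be the irreducible character of $S_n$ indexed by $\lambda$ (the character of the Specht module of shape $\lambda$). Let $\Lambda_n$ be the $K$-vector space of symmetric functions, homogeneous of degree $n$, in infinitely many variables $x_0,x_1,x_2,\dots$, and let $s_\lambda=\sum_T x^T$ be the Schur function indexed by $\lambda$, the sum being over the semistandard Young tableaux $T$ of shape $\lambda$. For $\sigma\in S_n$ let $m_j(\sigma)$ be the number of cycles of $\sigma$ of length $j$ (fixed points are cycles of length $1$). For a partition $\mu=(\mu_1\ge\mu_2\ge\dots\ge\mu_\ell>0)$ of $n$ let $m_\mu\in\mathcal{C}(S_n)$ be the cycle-counting function $$m_\mu(\sigma)=\prod_{i=2}^{\ell} m_{\mu_i}(\sigma),$$ in which the largest part $\mu_1$ is left out once (an empty product is $1$). Then there is a unique $K$-linear map $\mathrm{ch}:\mathcal{C}(S_n)\to\Lambda_n$ with $\mathrm{ch}(\chi^\lambda)=s_\lambda$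 for all $\lambda\vdash n$ (the characteristic map), and the family $(\mathrm{ch}(m_\mu))_{\mu\vdash n}$ is a basis of $\Lambda_n$. -/

import Mathlib

namespace CycleCount

noncomputable section

/-! ### Partitions and their Young diagrams -/

/-- The parts `μ₁ ≥ μ₂ ≥ …` of a partition, in nonincreasing order. -/
def sortedParts {n : ℕ} (μ : n.Partition) : List ℕ :=
  μ.parts.sort (· ≥ ·)

theorem sortedParts_sortedGE {n : ℕ} (μ : n.Partition) : (sortedParts μ).SortedGE :=
  (Multiset.pairwise_sort μ.parts (· ≥ ·)).sortedGE

theorem sortedParts_sum {n : ℕ} (μ : n.Partition) : (sortedParts μ).sum = n := by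
  rw [← Multiset.sum_coe, sortedParts, Multiset.sort_eq, μ.parts_sum]

/-- The Young diagram of a partition: row `i` (counted from `0`) has `μ_{i+1}` cells. -/
def diagram {n : ℕ} (μ : n.Partition) : YoungDiagram :=
  YoungDiagram.ofRowLens (sortedParts μ) (sortedParts_sortedGE μ)

theorem card_cellsOfRowLens (w : List ℕ) : (YoungDiagram.cellsOfRowLens w).card = w.sum := by
  induction w with
  | nil => simp [YoungDiagram.cellsOfRowLens]
  | cons a w ih =>
    rw [YoungDiagram.cellsOfRowLens, Finset.card_union_of_disjoint, Finset.card_map, ih]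
    · simp
    · rw [Finset.disjoint_left]
      rintro ⟨i, j⟩ h1 h2
      simp only [Finset.mem_product, Finset.mem_singleton] at h1
      simp only [Finset.mem_map] at h2
      obtain ⟨c, -, hc⟩ := h2
      have := congrArg Prod.fst hc
      simp [h1.1] at this

theorem card_diagram {n : ℕ} (μ : n.Partition) : (diagram μ).cells.card = n :=
  (card_cellsOfRowLens _).trans (sortedParts_sum μ)

/-! ### Class functions on the symmetric group and irreducible characters -/

/-- The space `𝒞(S_n)` of `K`-valued class functions on `S_n`. -/
def ClassFunctions (K : Type*) [Field K] (n : ℕ) :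
    Submodule K (Equiv.Perm (Fin n) → K) where
  carrier := {f | ∀ σ τ, IsConj σ τ → f σ = f τ}
  add_mem' hf hg σ τ h := by simp [hf σ τ h, hg σ τ h]
  zero_mem' _ _ _ := rfl
  smul_mem' c f hf σ τ h := by simp [hf σ τ h]

/-- A bijective tableau of shape `μ`: a numbering of the cells of the diagram of `μ` by `Fin n`.
The isomorphism class of the Specht module built from it does not depend on the numbering. -/
def tableau {n : ℕ} (μ : n.Partition) : Fin n ≃ (diagram μ).cells :=
  ((diagram μ).cells.equivFinOfCardEq (card_diagram μ)).symm

/-- The index of the row of the tableau that contains the number `i`. -/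
def tableauRow {n : ℕ} (μ : n.Partition) (i : Fin n) : ℕ := (tableau μ i).1.1

/-- The index of the column of the tableau that contains the number `i`. -/
def tableauCol {n : ℕ} (μ : n.Partition) (i : Fin n) : ℕ := (tableau μ i).1.2

/-- The row symmetrizer: the sum of all permutations that preserve every row. -/
def rowSymmetrizer (K : Type*) [Field K] {n : ℕ} (μ : n.Partition) :
    MonoidAlgebra K (Equiv.Perm (Fin n)) :=
  ∑ p : Equiv.Perm (Fin n) with ∀ i, tableauRow μ (p i) = tableauRow μ i,
    MonoidAlgebra.single p (1 : K)

/-- The column antisymmetrizer: the signed sum of all permutations that preserve every column. -/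
def colAntisymmetrizer (K : Type*) [Field K] {n : ℕ} (μ : n.Partition) :
    MonoidAlgebra K (Equiv.Perm (Fin n)) :=
  ∑ q : Equiv.Perm (Fin n) with ∀ i, tableauCol μ (q i) = tableauCol μ i,
    MonoidAlgebra.single q (((Equiv.Perm.sign q : ℤˣ) : ℤ) : K)

/-- The Young symmetrizer of `μ`. -/
def youngSymmetrizer (K : Type*) [Field K] {n : ℕ} (μ : n.Partition) :
    MonoidAlgebra K (Equiv.Perm (Fin n)) :=
  rowSymmetrizer K μ * colAntisymmetrizer K μ

/-- The Specht module of `μ`: the left ideal of the group algebra `K[S_n]` generated by the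
Young symmetrizer. -/
def spechtModule (K : Type*) [Field K] {n : ℕ} (μ : n.Partition) :
    Ideal (MonoidAlgebra K (Equiv.Perm (Fin n))) :=
  Ideal.span {youngSymmetrizer K μ}

/-- The irreducible representation of `S_n` indexed by `μ`: left multiplication on the
Specht module. -/
def spechtRep (K : Type*) [Field K] {n : ℕ} (μ : n.Partition) :
    Representation K (Equiv.Perm (Fin n)) (spechtModule K μ) :=
  Representation.ofModule' (spechtModule K μ)

/-- The irreducible character `χ^μ` of `S_n`, as a class function. -/
def irrChar (K : Type*) [Field K] {n : ℕ} (μ : n.Partition) : ClassFunctions K n :=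
  ⟨(spechtRep K μ).character, fun σ τ h => by
    obtain ⟨g, rfl⟩ := isConj_iff.1 h
    rw [Representation.char_mul_comm, inv_mul_cancel_left]⟩

/-! ### Cycle-counting functions -/

/-- `m_j(σ)`: the number of cycles of length `j` of `σ`; fixed points are the cycles of
length `1`. -/
def numCycles {n : ℕ} (j : ℕ) (σ : Equiv.Perm (Fin n)) : ℕ :=
  σ.partition.parts.count j

/-- The cycle-counting function `m_μ = ∏_{i ≥ 2} m_{μ_i}`, where `μ₁ ≥ μ₂ ≥ …` are the parts of
`μ`; the largest part `μ₁` is left out (once). -/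
def cycleCount (K : Type*) [Field K] {n : ℕ} (μ : n.Partition) : ClassFunctions K n :=
  ⟨fun σ => ((sortedParts μ).tail.map fun j => (numCycles j σ : K)).prod, fun σ τ h => by
    simp only [numCycles, Equiv.Perm.partition_eq_of_isConj.1 h]⟩

/-! ### Symmetric functions -/

/-- The space `Λ_n` of symmetric functions of degree `n` in the variables `x₀, x₁, x₂, …`: formal
power series that are homogeneous of degree `n` and whose coefficients are invariant under
permutations of the variables. -/
def SymmetricFunctions (K : Type*) [Field K] (n : ℕ) : Submodule K (MvPowerSeries ℕ K) where
  carrier := {f | (∀ d : ℕ →₀ ℕ, d.degree ≠ n → MvPowerSeries.coeff d f = 0) ∧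
    ∀ (e : Equiv.Perm ℕ) (d : ℕ →₀ ℕ),
      MvPowerSeries.coeff (d.mapDomain e) f = MvPowerSeries.coeff d f}
  add_mem' hf hg := ⟨fun d hd => by simp [hf.1 d hd, hg.1 d hd],
    fun e d => by simp [hf.2 e d, hg.2 e d]⟩
  zero_mem' := ⟨fun _ _ => by simp, fun _ _ => by simp⟩
  smul_mem' c f hf := ⟨fun d hd => by simp [hf.1 d hd], fun e d => by simp [hf.2 e d]⟩

/-- The Schur function `s_μ = ∑_T x^T`, the sum over all semistandard Young tableaux `T` of shape
`μ`: the coefficient of `x^d` is the (finite) number of such tableaux in which every `k` occurs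
exactly `d k` times. -/
def schurFunction (K : Type*) [Field K] {n : ℕ} (μ : n.Partition) : MvPowerSeries ℕ K :=
  fun d => (Nat.card {T : SemistandardYoungTableau (diagram μ) //
    ∀ k, ((diagram μ).cells.filter fun c => T c.1 c.2 = k).card = d k} : K)

/-- A linear map `ch : 𝒞(S_n) → Λ_n` is the characteristic map if `ch(χ^μ) = s_μ` for all
partitions `μ` of `n`. -/
def IsCharacteristicMap {K : Type*} [Field K] {n : ℕ}
    (ch : ClassFunctions K n →ₗ[K] SymmetricFunctions K n) : Prop :=
  ∀ μ : n.Partition, (ch (irrChar K μ) : MvPowerSeries ℕ K) = schurFunction K μ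

end

end CycleCount

namespace CycleCount
open Finset

/-! ### Triangular families -/

/-! The irreducible characters and the cycle-counting functions are two bases of the class
functions, and the Schur functions are a basis of `Λ_n`, all indexed by partitions. So `ch` is the
isomorphism matching the first basis with the third, and it carries the second to a basis. Each
family is independent because some functionals are triangular on it; it spans because class values,
or coefficients at partition exponents, bound the dimension by the number of partitions.

Characters: summing `χ^μ` over the row group of `l` detects row-group invariants in the Specht
module, which exist only if `μ` dominates `l` (`cellsAbove_le_of_rowSymmetrizer_mul_ne_zero`). Schur
functions: the coefficient of `x^l` in `s_μ` obeys the same order, and symmetry comes from the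
Bender-Knuth involution, which on Gelfand-Tsetlin patterns is a reflection of intervals
(`card_tableaux_swap`).

Cycle counts: replacing powers of the `m_j` by falling factorials gives functions that vanish on
permutations with too few cycles, hence a family triangular for the number of parts. It lies in the
span of the `m_ν`, because factors deleted from `m_μ` can be absorbed into the omitted largest part
(`exists_cycleCount_eq_powCount`). -/

theorem linearIndependent_of_triangular {K V ι β : Type*} [Field K] [AddCommGroup V] [Module K V]
    [Finite ι] [Preorder β] (key : ι → β) (φ : ι → V →ₗ[K] K) (v : ι → V)
    (hdiag : ∀ i, φ i (v i) ≠ 0) (htri : ∀ i j, φ i (v j) ≠ 0 → i = j ∨ key i < key j) :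
    LinearIndependent K v := by
  classical
  cases nonempty_fintype ι
  rw [Fintype.linearIndependent_iff]
  intro c hc
  by_contra! hne
  -- At an index of maximal key among the nonzero coefficients, `φ i` kills every other term of the
  -- relation.
  obtain ⟨i, hi, hmax⟩ := Finset.exists_maximalFor key (univ.filter fun i => c i ≠ 0)
    (by simpa [Finset.Nonempty] using hne)
  simp only [mem_filter, mem_univ, true_and] at hi hmax
  have h := congrArg (φ i) hc
  rw [map_sum, map_zero, Finset.sum_eq_single i] at h
  · simp [hi, hdiag i] at h
  · intro j _ hj
    rw [map_smul, smul_eq_mul]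
    by_contra h0
    obtain ⟨h1, h2⟩ := mul_ne_zero_iff.1 h0
    rcases htri i j h2 with rfl | hlt
    · exact hj rfl
    · exact hlt.not_ge (hmax h1 hlt.le)
  · simp

theorem exists_basis_of_linearIndependent {K V ι : Type*} [Field K] [AddCommGroup V] [Module K V]
    [Fintype ι] {v : ι → V} (hv : LinearIndependent K v) (f : V →ₗ[K] (ι → K))
    (hf : Function.Injective f) : ∃ b : Module.Basis ι K V, ∀ i, b i = v i := by
  have : FiniteDimensional K V := FiniteDimensional.of_injective f hf
  have h1 : Module.finrank K V ≤ Fintype.card ι := by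
    simpa using LinearMap.finrank_le_finrank_of_injective hf
  have h2 := hv.fintype_card_le_finrank
  exact ⟨Module.Basis.mk hv (hv.span_eq_top_of_card_eq_finrank' (le_antisymm h2 h1)).ge, by simp⟩

/-! ### Dominance order -/

/-- The number of cells in the first `k` rows. -/
def cellsAbove (D : YoungDiagram) (k : ℕ) : ℕ := #{c ∈ D.cells | c.1 < k}

/-- Count by columns: a column on which `f` is injective has at most `min k (colLen)` cells with `f
< k`, exactly the number it has in the first `k` rows. This is the source of dominance for both
characters and Schur functions. -/
theorem card_filter_lt_le_cellsAbove (D : YoungDiagram) (f : ℕ × ℕ → ℕ)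
    (hf : ∀ c ∈ D.cells, ∀ c' ∈ D.cells, c.2 = c'.2 → f c = f c' → c = c') (k : ℕ) :
    #{c ∈ D.cells | f c < k} ≤ cellsAbove D k := by
  classical
  rw [cellsAbove, card_eq_sum_card_fiberwise (f := Prod.snd) (t := D.cells.image Prod.snd)
      (by intro c hc; exact mem_image_of_mem _ (mem_filter.1 hc).1),
    card_eq_sum_card_fiberwise (f := Prod.snd) (s := {c ∈ D.cells | c.1 < k})
      (t := D.cells.image Prod.snd)
      (by intro c hc; exact mem_image_of_mem _ (mem_filter.1 hc).1)]
  refine sum_le_sum fun j _ => ?_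
  have h2 : #{c ∈ {c ∈ D.cells | c.1 < k} | c.2 = j} = min k (D.colLen j) := by
    rw [← card_range (min k (D.colLen j))]
    refine card_nbij' Prod.fst (fun i => (i, j)) ?_ ?_ ?_ ?_
    · rintro ⟨i, j'⟩ h
      simp only [coe_filter, mem_filter, Set.mem_ofPred_eq, YoungDiagram.mem_cells,
        coe_range, Set.mem_Iio] at h ⊢
      obtain ⟨⟨h1, h2⟩, rfl⟩ := h
      exact lt_min h2 (YoungDiagram.mem_iff_lt_colLen.1 h1)
    · intro i h
      simp only [coe_filter, mem_filter, Set.mem_ofPred_eq, YoungDiagram.mem_cells,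
        coe_range, Set.mem_Iio, lt_min_iff, YoungDiagram.mem_iff_lt_colLen] at h ⊢
      tauto
    · rintro ⟨i, j'⟩ h
      simp only [coe_filter, mem_filter, Set.mem_ofPred_eq] at h
      simp [h.2]
    · intro i _; rfl
  rw [h2]
  refine le_min ?_ ?_
  · rw [← card_range k]
    refine card_le_card_of_injOn f ?_ ?_
    · intro c hc
      simp only [coe_filter, mem_filter, Set.mem_ofPred_eq] at hc
      simpa using hc.1.2
    · intro c hc c' hc' h
      simp only [coe_filter, mem_filter, Set.mem_ofPred_eq] at hc hc'
      exact hf c hc.1.1 c' hc'.1.1 (hc.2.trans hc'.2.symm) h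
  · rw [YoungDiagram.colLen_eq_card]
    refine card_le_card fun c hc => ?_
    simp only [mem_filter] at hc
    exact YoungDiagram.mem_col_iff.2 ⟨hc.1.1, hc.2⟩

theorem cellsAbove_succ (D : YoungDiagram) (k : ℕ) :
    cellsAbove D (k + 1) = cellsAbove D k + D.rowLen k := by
  classical
  rw [cellsAbove, cellsAbove, YoungDiagram.rowLen_eq_card, ← card_union_of_disjoint]
  · congr 1
    ext c
    simp only [mem_filter, mem_union, YoungDiagram.mem_row_iff, YoungDiagram.mem_cells,
      Nat.lt_succ_iff_lt_or_eq]
    tauto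
  · rw [disjoint_left]
    intro c h1 h2
    have := (mem_filter.1 h1).2
    have := (YoungDiagram.mem_row_iff.1 h2).2
    omega

theorem rowLens_diagram {n : ℕ} (μ : n.Partition) : (diagram μ).rowLens = sortedParts μ :=
  YoungDiagram.rowLens_ofRowLens_eq_self fun _ hx => μ.parts_pos ((Multiset.mem_sort _).1 hx)

theorem diagram_injective {n : ℕ} : Function.Injective (diagram (n := n)) := fun μ ν h => by
  have h1 : sortedParts μ = sortedParts ν := by rw [← rowLens_diagram, h, rowLens_diagram]
  ext1
  rw [← Multiset.sort_eq μ.parts (· ≥ ·), ← Multiset.sort_eq ν.parts (· ≥ ·)]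
  exact congrArg _ h1

theorem cellsAbove_injective : Function.Injective cellsAbove := fun D E h => by
  ext ⟨i, j⟩
  have h1 := cellsAbove_succ D i
  rw [h, cellsAbove_succ] at h1
  simp only [YoungDiagram.mem_cells, YoungDiagram.mem_iff_lt_rowLen]
  omega

/-- The pointwise order on `cellsAbove` is the dominance order; it is antisymmetric because
successive differences recover the row lengths. -/
theorem eq_or_lt_of_cellsAbove_le {n : ℕ} {μ ν : n.Partition}
    (h : ∀ k, cellsAbove (diagram μ) k ≤ cellsAbove (diagram ν) k) :
    μ = ν ∨ cellsAbove (diagram μ) < cellsAbove (diagram ν) := by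
  rcases eq_or_lt_of_le (show cellsAbove (diagram μ) ≤ cellsAbove (diagram ν) from h) with h | h
  · exact Or.inl (diagram_injective (cellsAbove_injective h))
  · exact Or.inr h

/-! ### The irreducible characters form a basis of the class functions -/

/-- The permutations that preserve every row of the tableau of shape `μ`. -/
noncomputable def rowGroup {n : ℕ} (μ : n.Partition) : Subgroup (Equiv.Perm (Fin n)) where
  carrier := {p | ∀ i, tableauRow μ (p i) = tableauRow μ i}
  mul_mem' {p q} hp hq i := by simpa using (hp (q i)).trans (hq i)
  one_mem' _ := rfl
  inv_mem' {p} hp i := by simpa using (hp (p⁻¹ i)).symm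

theorem mem_rowGroup {n : ℕ} {μ : n.Partition} {p : Equiv.Perm (Fin n)} :
    p ∈ rowGroup μ ↔ ∀ i, tableauRow μ (p i) = tableauRow μ i := Iff.rfl

theorem tableau_ext {n : ℕ} (μ : n.Partition) {i j : Fin n}
    (hr : tableauRow μ i = tableauRow μ j) (hc : tableauCol μ i = tableauCol μ j) : i = j :=
  (tableau μ).injective (Subtype.ext (Prod.ext hr hc))

section

variable {K : Type*} [Field K] {n : ℕ}

theorem rowSymmetrizer_mul_single {μ : n.Partition} {p : Equiv.Perm (Fin n)}
    (hp : p ∈ rowGroup μ) :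
    rowSymmetrizer K μ * MonoidAlgebra.single p 1 = rowSymmetrizer K μ := by
  rw [rowSymmetrizer, sum_mul]
  refine sum_nbij' (· * p) (· * p⁻¹) ?_ ?_ ?_ ?_ ?_
  · intro q hq
    simp only [mem_filter, mem_univ, true_and, ← mem_rowGroup] at hq ⊢
    exact mul_mem hq hp
  · intro q hq
    simp only [mem_filter, mem_univ, true_and, ← mem_rowGroup] at hq ⊢
    exact mul_mem hq (inv_mem hp)
  · intro q _; simp
  · intro q _; simp
  · intro q _; simp [MonoidAlgebra.single_mul_single]

theorem single_mul_rowSymmetrizer {μ : n.Partition} {p : Equiv.Perm (Fin n)}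
    (hp : p ∈ rowGroup μ) :
    MonoidAlgebra.single p 1 * rowSymmetrizer K μ = rowSymmetrizer K μ := by
  rw [rowSymmetrizer, mul_sum]
  refine sum_nbij' (p * ·) (p⁻¹ * ·) ?_ ?_ ?_ ?_ ?_
  · intro q hq
    simp only [mem_filter, mem_univ, true_and, ← mem_rowGroup] at hq ⊢
    exact mul_mem hp hq
  · intro q hq
    simp only [mem_filter, mem_univ, true_and, ← mem_rowGroup] at hq ⊢
    exact mul_mem (inv_mem hp) hq
  · intro q _; simp
  · intro q _; simp
  · intro q _; simp [MonoidAlgebra.single_mul_single]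

theorem single_swap_mul_colAntisymmetrizer {μ : n.Partition} {i j : Fin n} (hij : i ≠ j)
    (h : tableauCol μ i = tableauCol μ j) :
    MonoidAlgebra.single (Equiv.swap i j) 1 * colAntisymmetrizer K μ
      = -colAntisymmetrizer K μ := by
  have hs : ∀ x, tableauCol μ (Equiv.swap i j x) = tableauCol μ x := by
    intro x
    rw [Equiv.swap_apply_def]
    split_ifs with h1 h2
    · rw [h1, h]
    · rw [h2, h]
    · rfl
  rw [colAntisymmetrizer, mul_sum, ← sum_neg_distrib]
  refine sum_nbij' (Equiv.swap i j * ·) (Equiv.swap i j * ·) ?_ ?_ ?_ ?_ ?_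
  · intro q hq
    simp only [mem_filter, mem_univ, true_and, Equiv.Perm.mul_apply, hs] at hq ⊢
    exact hq
  · intro q hq
    simp only [mem_filter, mem_univ, true_and, Equiv.Perm.mul_apply, hs] at hq ⊢
    exact hq
  · intro q _; simp
  · intro q _; simp
  · intro q _
    rw [MonoidAlgebra.single_mul_single, ← MonoidAlgebra.single_neg]
    simp [Equiv.Perm.sign_swap hij]

/-- A permutation preserving all rows and all columns is the identity, so `p * q = 1` only for `p =
q = 1`. In particular the Young symmetrizer is nonzero. -/
theorem coeff_one_youngSymmetrizer (μ : n.Partition) :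
    (youngSymmetrizer K μ).coeff 1 = 1 := by
  rw [youngSymmetrizer, rowSymmetrizer, colAntisymmetrizer, sum_mul_sum]
  simp only [MonoidAlgebra.single_mul_single, one_mul, MonoidAlgebra.coeff_sum,
    Finsupp.finsetSum_apply, MonoidAlgebra.coeff_single, Finsupp.single_apply]
  rw [sum_eq_single 1, sum_eq_single 1]
  · simp
  · intro q _ hq
    simp [hq]
  · simp
  · intro p hp hp1
    refine sum_eq_zero fun q hq => if_neg fun hpq => hp1 ?_
    simp only [mem_filter, mem_univ, true_and] at hp hq
    obtain rfl := eq_inv_of_mul_eq_one_left hpq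
    refine inv_eq_one.2 (Equiv.ext fun i => tableau_ext μ ?_ (hq i))
    simpa using (hp (q i)).symm
  · simp

/-- If `g` sent two entries of one column of `μ` into one row of `l`, their transposition would be
absorbed on the left and give a sign on the right, so the product would equal its own negative.
Hence the rows of `l` label the cells of `μ` injectively in each column. -/
theorem cellsAbove_le_of_rowSymmetrizer_mul_ne_zero [CharZero K] {l μ : n.Partition}
    {x : MonoidAlgebra K (Equiv.Perm (Fin n))}
    (hx : rowSymmetrizer K l * x * colAntisymmetrizer K μ ≠ 0) (k : ℕ) :
    cellsAbove (diagram l) k ≤ cellsAbove (diagram μ) k := by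
  classical
  -- By linearity `x` may be replaced by a single group element.
  obtain ⟨g, hg⟩ : ∃ g : Equiv.Perm (Fin n),
      rowSymmetrizer K l * MonoidAlgebra.single g 1 * colAntisymmetrizer K μ ≠ 0 := by
    by_contra! h
    apply hx
    induction x using MonoidAlgebra.induction_linear with
    | zero => simp
    | add x y hx hy =>
      by_cases h1 : rowSymmetrizer K l * x * colAntisymmetrizer K μ = 0 <;>
      by_cases h2 : rowSymmetrizer K l * y * colAntisymmetrizer K μ = 0 <;>
      simp_all [mul_add, add_mul]
    | single g c =>
      have : MonoidAlgebra.single g c = c • MonoidAlgebra.single g (1 : K) := by simp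
      rw [this, mul_smul_comm, smul_mul_assoc, h, smul_zero]
  have hinj : ∀ i j, tableauCol μ i = tableauCol μ j →
      tableauRow l (g i) = tableauRow l (g j) → i = j := by
    intro i j hc hr
    by_contra hij
    have hp : Equiv.swap (g i) (g j) ∈ rowGroup l := by
      intro x
      rw [Equiv.swap_apply_def]
      split_ifs with h1 h2
      · rw [h1, hr]
      · rw [h2, hr]
      · rfl
    have hsw : Equiv.swap (g i) (g j) * g = g * Equiv.swap i j := by
      rw [Equiv.swap_apply_apply]; group
    have h1 : rowSymmetrizer K l * MonoidAlgebra.single g 1 * colAntisymmetrizer K μ =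
        -(rowSymmetrizer K l * MonoidAlgebra.single g 1 * colAntisymmetrizer K μ) := by
      nth_rewrite 1 [← rowSymmetrizer_mul_single hp]
      rw [mul_assoc (rowSymmetrizer K l), MonoidAlgebra.single_mul_single, hsw, mul_one,
        ← mul_neg, ← single_swap_mul_colAntisymmetrizer hij hc,
        mul_assoc (rowSymmetrizer K l) (MonoidAlgebra.single g 1),
        ← mul_assoc (MonoidAlgebra.single g 1), MonoidAlgebra.single_mul_single, mul_one, mul_assoc]
    rw [eq_neg_iff_add_eq_zero, ← two_smul K] at h1
    exact (smul_ne_zero two_ne_zero hg) h1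
  let f : ℕ × ℕ → ℕ := fun c => if h : c ∈ (diagram μ).cells then
    tableauRow l (g ((tableau μ).symm ⟨c, h⟩)) else 0
  have hf : ∀ i, f (tableau μ i).1 = tableauRow l (g i) := fun i => by simp [f]
  refine le_trans (le_of_eq ?_) (card_filter_lt_le_cellsAbove (diagram μ) f ?_ k)
  · have h1 : ∀ (ν : n.Partition) (F : ℕ × ℕ → Prop) [DecidablePred F],
        #{c ∈ (diagram ν).cells | F c} = #{i : Fin n | F (tableau ν i).1} := by
      intro ν F _
      symm
      refine card_bij (fun i _ => (tableau ν i).1) ?_ ?_ ?_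
      · intro i hi
        simp only [mem_filter, mem_univ, true_and] at hi
        exact mem_filter.2 ⟨(tableau ν i).2, hi⟩
      · intro i _ j _ h
        exact (tableau ν).injective (Subtype.ext h)
      · intro c hc
        obtain ⟨h1, h2⟩ := mem_filter.1 hc
        exact ⟨(tableau ν).symm ⟨c, h1⟩, by simpa using h2, by simp⟩
    rw [cellsAbove, h1, h1]
    symm
    refine card_bij (fun i _ => g i) ?_ ?_ ?_
    · intro i hi
      simpa [hf, tableauRow] using hi
    · intro i _ j _ h
      exact g.injective h
    · intro i hi
      refine ⟨g⁻¹ i, ?_, by simp⟩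
      simpa [hf, tableauRow] using hi
  · intro c hc c' hc' h1 h2
    obtain ⟨i, hi⟩ := (tableau μ).surjective ⟨c, hc⟩
    obtain ⟨j, hj⟩ := (tableau μ).surjective ⟨c', hc'⟩
    obtain rfl : (tableau μ i).1 = c := by rw [hi]
    obtain rfl : (tableau μ j).1 = c' := by rw [hj]
    rw [hf, hf] at h2
    rw [hinj i j h1 h2]

theorem coe_spechtRep_apply (μ : n.Partition) (g : Equiv.Perm (Fin n)) (x : spechtModule K μ) :
    (spechtRep K μ g x : MonoidAlgebra K (Equiv.Perm (Fin n))) =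
      MonoidAlgebra.single g 1 * (x : MonoidAlgebra K (Equiv.Perm (Fin n))) := by
  simp [spechtRep, Representation.ofModule', MonoidAlgebra.lift_symm_apply]

instance finite_spechtModule (μ : n.Partition) : FiniteDimensional K (spechtModule K μ) :=
  FiniteDimensional.of_injective ((spechtModule K μ).subtype.restrictScalars K)
    Subtype.val_injective

/-- The sum of the values of a class function on the permutations that preserve every row. -/
noncomputable def rowGroupSum (K : Type*) [Field K] {n : ℕ} (l : n.Partition) : ClassFunctions K n →ₗ[K] K where
  toFun f := ∑ p : Equiv.Perm (Fin n) with ∀ i, tableauRow l (p i) = tableauRow l i, f.1 p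
  map_add' f g := by simp [sum_add_distrib]
  map_smul' c f := by simp [mul_sum]

/-- The vectors of the Specht module of `μ` fixed by the row group of `l`. -/
noncomputable def rowInvariants (K : Type*) [Field K] {n : ℕ} (l μ : n.Partition) :
    Submodule K (spechtModule K μ) :=
  Representation.invariants ((spechtRep K μ).comp (rowGroup l).subtype)

theorem rowSymmetrizer_mul_of_mem_rowInvariants {l μ : n.Partition} {x : spechtModule K μ}
    (hx : x ∈ rowInvariants K l μ) :
    rowSymmetrizer K l * (x : MonoidAlgebra K (Equiv.Perm (Fin n))) =
      (#{p : Equiv.Perm (Fin n) | ∀ i, tableauRow l (p i) = tableauRow l i} : K) •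
        (x : MonoidAlgebra K (Equiv.Perm (Fin n))) := by
  rw [rowSymmetrizer, sum_mul, Nat.cast_smul_eq_nsmul]
  refine sum_eq_card_nsmul fun p hp => ?_
  rw [← coe_spechtRep_apply]
  exact congrArg Subtype.val (hx ⟨p, by simpa [mem_rowGroup] using hp⟩)

/-- The average of a character over a subgroup is the dimension of the invariants, which
characteristic zero does not collapse. -/
theorem rowGroupSum_irrChar_ne_zero_iff [CharZero K] (l μ : n.Partition) :
    rowGroupSum K l (irrChar K μ) ≠ 0 ↔ rowInvariants K l μ ≠ ⊥ := by
  classical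
  have hc : (Nat.card (rowGroup l) : K) ≠ 0 := Nat.cast_ne_zero.2 Nat.card_pos.ne'
  have := invertibleOfNonzero hc
  have h := Representation.card_inv_mul_sum_char_eq_finrank
    ((spechtRep K μ).comp (rowGroup l).subtype)
  have h2 : rowGroupSum K l (irrChar K μ) =
      ∑ g : rowGroup l, Representation.character ((spechtRep K μ).comp (rowGroup l).subtype) g := by
    exact Finset.sum_subtype _ (by simp [mem_rowGroup]) _
  rw [h2, ← Submodule.one_le_finrank_iff, Nat.one_le_iff_ne_zero, ← Nat.cast_ne_zero (R := K),
    rowInvariants, ← h]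
  simp

theorem linearIndependent_irrChar [CharZero K] :
    LinearIndependent K (fun μ : n.Partition => irrChar K μ) := by
  refine linearIndependent_of_triangular (fun μ : n.Partition => cellsAbove (diagram μ))
    (rowGroupSum K) _ (fun l => ?_) (fun l μ h => ?_)
  · rw [rowGroupSum_irrChar_ne_zero_iff, Submodule.ne_bot_iff]
    refine ⟨⟨youngSymmetrizer K l, Ideal.mem_span_singleton_self _⟩, ?_, ?_⟩
    · rintro ⟨p, hp⟩
      refine Subtype.ext ((coe_spechtRep_apply l p _).trans ?_)
      change MonoidAlgebra.single p 1 * youngSymmetrizer K l = youngSymmetrizer K l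
      rw [youngSymmetrizer, ← mul_assoc, single_mul_rowSymmetrizer hp]
    · intro h0
      have := coeff_one_youngSymmetrizer (K := K) l
      rw [show youngSymmetrizer K l = 0 from congrArg Subtype.val h0] at this
      simp at this
  · rw [rowGroupSum_irrChar_ne_zero_iff, Submodule.ne_bot_iff] at h
    obtain ⟨x, hinv, hx0⟩ := h
    obtain ⟨y, hy⟩ := Ideal.mem_span_singleton'.1 x.2
    -- A nonzero invariant is `y` times the Young symmetrizer of `μ`; the row symmetrizer of `l`
    -- multiplies it by the order of the row group, so the product does not vanish.
    refine eq_or_lt_of_cellsAbove_le fun k =>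
      cellsAbove_le_of_rowSymmetrizer_mul_ne_zero (K := K) (x := y * rowSymmetrizer K μ) ?_ k
    rw [mul_assoc, mul_assoc y, ← youngSymmetrizer, hy, rowSymmetrizer_mul_of_mem_rowInvariants hinv]
    exact smul_ne_zero (Nat.cast_ne_zero.2 (card_ne_zero_of_mem (a := 1) (by simp)))
      (by simpa using hx0)

end

/-! ### The cycle-counting functions form a basis of the class functions -/

section

variable {K : Type*} [Field K] {n : ℕ}

theorem exists_perm_parts (l : n.Partition) :
    ∃ σ : Equiv.Perm (Fin n), σ.partition.parts = l.parts := by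
  -- The cycle type records only cycles of length at least `2`; the parts equal to `1` must be
  -- recovered as fixed points.
  have hone : ∀ x ∈ l.parts.filter (fun k => ¬ 2 ≤ k), x = 1 := by
    intro x hx
    obtain ⟨h1, h2⟩ := Multiset.mem_filter.1 hx
    have := l.parts_pos h1
    omega
  have hsplit := Multiset.filter_add_not (fun k => 2 ≤ k) l.parts
  rw [Multiset.eq_replicate_of_mem hone] at hsplit
  have hsum := congrArg Multiset.sum hsplit
  rw [Multiset.sum_add, Multiset.sum_replicate, l.parts_sum, smul_eq_mul, mul_one] at hsum
  obtain ⟨σ, hσ⟩ := (Equiv.Perm.exists_with_cycleType_iff (Fin n)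
    (m := l.parts.filter (fun k => 2 ≤ k))).2
    ⟨by simp; omega, fun a ha => (Multiset.mem_filter.1 ha).2⟩
  refine ⟨σ, ?_⟩
  rw [Equiv.Perm.parts_partition, ← Equiv.Perm.sum_cycleType, hσ, Fintype.card_fin, ← hsplit,
    hsplit]
  nth_rewrite 3 [← hsplit]
  congr 2
  omega

/-- A permutation of cycle type `l`. -/
noncomputable def permOfPartition (l : n.Partition) : Equiv.Perm (Fin n) :=
  (exists_perm_parts l).choose

theorem parts_permOfPartition (l : n.Partition) :
    (permOfPartition l).partition.parts = l.parts :=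
  (exists_perm_parts l).choose_spec

theorem exists_isConj_permOfPartition (σ : Equiv.Perm (Fin n)) :
    ∃ l : n.Partition, IsConj (permOfPartition l) σ := by
  refine ⟨⟨σ.partition.parts, σ.partition.parts_pos, by simpa using σ.partition.parts_sum⟩, ?_⟩
  rw [Equiv.Perm.partition_eq_of_isConj, Nat.Partition.ext_iff, parts_permOfPartition]

/-- The values of a class function on the conjugacy classes. -/
noncomputable def classValues (K : Type*) [Field K] (n : ℕ) :
    ClassFunctions K n →ₗ[K] (n.Partition → K) where
  toFun f l := f.1 (permOfPartition l)
  map_add' _ _ := rfl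
  map_smul' _ _ := rfl

theorem classValues_injective : Function.Injective (classValues K n) := fun f g h => by
  ext σ
  obtain ⟨l, hl⟩ := exists_isConj_permOfPartition σ
  rw [← f.2 _ _ hl, ← g.2 _ _ hl]
  exact congrFun h l

/-- The product of the cycle counts `m_j` over the entries `j` of a list. -/
def powCount (K : Type*) [Field K] {n : ℕ} (l : List ℕ) (σ : Equiv.Perm (Fin n)) : K :=
  (l.map fun j => (numCycles j σ : K)).prod

/-- The product of the falling factorials of `m_j` of length the multiplicity of `j` in a list. -/
def fallingCount (K : Type*) [Field K] {n : ℕ} : List ℕ → Equiv.Perm (Fin n) → K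
  | [] => fun _ => 1
  | a :: l => fun σ => fallingCount K l σ * (numCycles a σ - l.count a)

/-- A falling factorial of `m_j` of length `c` is nonzero exactly when `c ≤ m_j`. -/
theorem fallingCount_ne_zero_iff [CharZero K] (l : List ℕ) (σ : Equiv.Perm (Fin n)) :
    fallingCount K l σ ≠ 0 ↔ (l : Multiset ℕ) ≤ σ.partition.parts := by
  induction l with
  | nil => simp [fallingCount]
  | cons a l ih =>
    rw [fallingCount, mul_ne_zero_iff, ih, sub_ne_zero, Nat.cast_injective.ne_iff,
      ← Multiset.cons_coe]
    constructor
    · rintro ⟨h1, h2⟩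
      rw [Multiset.le_iff_count] at h1 ⊢
      intro b
      have hb := h1 b
      rw [Multiset.count_cons]
      split_ifs with hab
      · subst hab
        rw [Multiset.coe_count] at hb ⊢
        exact lt_of_le_of_ne hb (Ne.symm h2)
      · exact hb
    · intro h
      refine ⟨(Multiset.le_cons_self _ _).trans h, ?_⟩
      have := Multiset.le_iff_count.1 h a
      rw [Multiset.count_cons_self, Multiset.coe_count] at this
      exact (Nat.lt_of_succ_le this).ne'

theorem fallingCount_mem_span (l : List ℕ) :
    fallingCount K l ∈ Submodule.span K
      {f : Equiv.Perm (Fin n) → K | ∃ t : List ℕ, (t : Multiset ℕ) ≤ l ∧ f = powCount K t} := by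
  induction l with
  | nil => exact Submodule.subset_span ⟨[], le_rfl, by ext; simp [fallingCount, powCount]⟩
  | cons a l ih =>
    let A : (Equiv.Perm (Fin n) → K) →ₗ[K] (Equiv.Perm (Fin n) → K) :=
      LinearMap.mulRight K (fun σ => (numCycles a σ - l.count a : K))
    change A (fallingCount K l) ∈ _
    refine (Submodule.map_span_le A _ _).2 ?_ (Submodule.mem_map_of_mem ih)
    rintro f ⟨t, ht, rfl⟩
    -- Multiplication by `m_a - c` yields only the lists `a :: t` and `t`, both contained in `a ::
    -- l`.
    have h1 : A (powCount K t) = powCount K (a :: t) - (l.count a : K) • powCount K t := by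
      ext σ
      simp only [A, LinearMap.mulRight_apply, Pi.mul_apply, powCount, List.map_cons,
        List.prod_cons, Pi.sub_apply, Pi.smul_apply, smul_eq_mul]
      ring
    rw [h1, ← Multiset.cons_coe]
    refine Submodule.sub_mem _ (Submodule.subset_span ⟨a :: t, ?_, rfl⟩)
      (Submodule.smul_mem _ _ (Submodule.subset_span ⟨t, ht.trans (Multiset.le_cons_self _ _), rfl⟩))
    exact Multiset.cons_le_cons a ht

theorem coe_cycleCount (μ : n.Partition) :
    (cycleCount K μ : Equiv.Perm (Fin n) → K) = powCount K (sortedParts μ).tail := rfl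

theorem coe_sortedParts (μ : n.Partition) : (sortedParts μ : Multiset ℕ) = μ.parts :=
  Multiset.sort_eq _ _

theorem exists_cycleCount_eq_powCount (μ : n.Partition) {t : List ℕ}
    (ht : (t : Multiset ℕ) ≤ (sortedParts μ).tail) :
    ∃ ν : n.Partition, (cycleCount K ν : Equiv.Perm (Fin n) → K) = powCount K t := by
  rcases hμ : sortedParts μ with _ | ⟨a, s⟩
  · refine ⟨μ, ?_⟩
    rw [hμ] at ht
    have : t = [] := by simpa using ht
    rw [coe_cycleCount, hμ, this]
    rfl
  · rw [hμ, List.tail_cons] at ht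
    have hparts : μ.parts = a ::ₘ (s : Multiset ℕ) := by
      rw [← coe_sortedParts, hμ, Multiset.cons_coe]
    have hsum := μ.parts_sum
    rw [hparts, Multiset.sum_cons] at hsum
    obtain ⟨u, hu⟩ := Multiset.le_iff_exists_add.1 ht
    have hst : (s : Multiset ℕ).sum = (t : Multiset ℕ).sum + u.sum := by
      rw [hu, Multiset.sum_add]
    have ha : 0 < a := μ.parts_pos (by simp [hparts])
    have hmem : ∀ x ∈ (t : Multiset ℕ), x ∈ s := fun x hx => by
      simpa using Multiset.mem_of_le ht hx
    have hsorted := (sortedParts_sortedGE μ).pairwise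
    rw [hμ, List.pairwise_cons] at hsorted
    -- The deleted parts `u` are added to the largest part, which stays largest and is again the one
    -- left out.
    let ν : n.Partition := ⟨(a + u.sum) ::ₘ (t : Multiset ℕ), by
      intro i hi
      rcases Multiset.mem_cons.1 hi with rfl | hi
      · omega
      · exact μ.parts_pos (by simpa [hparts] using Or.inr (hmem i hi)), by
      rw [Multiset.sum_cons]; omega⟩
    refine ⟨ν, ?_⟩
    have h1 : sortedParts ν = (a + u.sum) :: (t : Multiset ℕ).sort (· ≥ ·) := by
      refine Multiset.sort_cons (a + u.sum) (t : Multiset ℕ) (fun x y : ℕ => x ≥ y) fun b hb => ?_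
      have h2 : b ≤ a := hsorted.1 b (hmem b hb)
      exact h2.trans (Nat.le_add_right _ _)
    rw [coe_cycleCount, h1, List.tail_cons]
    ext σ
    refine List.Perm.prod_eq (List.Perm.map _ (Multiset.coe_eq_coe.1 ?_))
    exact Multiset.sort_eq _ _

/-- What `l` has beyond the tail of `μ` sums to `μ₁ > 0`: it is either the single part `μ₁` or at
least two parts. -/
theorem eq_or_card_lt_of_tail_le {l μ : n.Partition}
    (h : ((sortedParts μ).tail : Multiset ℕ) ≤ l.parts) :
    l = μ ∨ μ.parts.card < l.parts.card := by
  have hμ' := coe_sortedParts μ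
  rcases hμ : sortedParts μ with _ | ⟨a, s⟩
  · rw [hμ] at hμ'
    have h1 := μ.parts_sum
    rw [← hμ'] at h1
    obtain rfl : 0 = n := by simpa using h1
    exact Or.inl (Subsingleton.elim _ _)
  · rw [hμ, List.tail_cons] at h
    rw [hμ, ← Multiset.cons_coe] at hμ'
    obtain ⟨u, hu⟩ := Multiset.le_iff_exists_add.1 h
    have h1 := μ.parts_sum
    have h2 := l.parts_sum
    rw [← hμ', Multiset.sum_cons] at h1
    rw [hu, Multiset.sum_add] at h2
    have hsum : u.sum = a := by omega
    have ha : 0 < a := μ.parts_pos (by simp [← hμ'])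
    have hcard : u.card ≠ 0 := by
      intro h0
      rw [Multiset.card_eq_zero.1 h0, Multiset.sum_zero] at hsum
      omega
    rcases eq_or_ne u.card 1 with h3 | h3
    · left
      obtain ⟨b, rfl⟩ := Multiset.card_eq_one.1 h3
      ext1
      rw [hu, ← hμ', ← hsum, Multiset.sum_singleton, add_comm, Multiset.singleton_add]
    · right
      rw [hu, ← hμ', Multiset.card_cons, Multiset.card_add]
      omega

theorem linearIndependent_cycleCount [CharZero K] :
    LinearIndependent K (fun μ : n.Partition => cycleCount K μ) := by
  refine LinearIndependent.of_comp (ClassFunctions K n).subtype ?_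
  -- It suffices that the span contains an independent family of the same size, the falling
  -- products.
  rw [linearIndependent_iff_card_le_finrank_span]
  have h1 : LinearIndependent K
      (fun μ : n.Partition => fallingCount K (n := n) (sortedParts μ).tail) := by
    refine linearIndependent_of_triangular (fun μ => OrderDual.toDual μ.parts.card)
      (fun l => LinearMap.proj (permOfPartition l)) _ (fun l => ?_) (fun l μ h => ?_)
    · rw [LinearMap.proj_apply, fallingCount_ne_zero_iff, parts_permOfPartition,
        ← coe_sortedParts, Multiset.coe_le]
      exact (List.tail_sublist _).subperm
    · rw [LinearMap.proj_apply, fallingCount_ne_zero_iff, parts_permOfPartition] at h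
      exact eq_or_card_lt_of_tail_le h
  rw [← finrank_span_eq_card h1]
  refine Submodule.finrank_mono (Submodule.span_le.2 ?_)
  rintro _ ⟨μ, rfl⟩
  refine Submodule.span_mono ?_ (fallingCount_mem_span _)
  rintro _ ⟨t, ht, rfl⟩
  exact exists_cycleCount_eq_powCount μ ht

end

/-! ### Gelfand-Tsetlin patterns and the Bender-Knuth involution -/

/-- A Gelfand-Tsetlin pattern for the Young diagram `D`: `g m i` stands for the number of entries
less than `m` in row `i` of a semistandard tableau of shape `D`. -/
structure IsGelfandTsetlin (D : YoungDiagram) (g : ℕ → ℕ → ℕ) : Prop where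
  zero : ∀ i, g 0 i = 0
  mono_succ : ∀ m i, g m i ≤ g (m + 1) i
  interlace : ∀ m i, g (m + 1) (i + 1) ≤ g m i
  eventually : ∃ N, ∀ m, N ≤ m → ∀ i, g m i = D.rowLen i

namespace IsGelfandTsetlin

variable {D : YoungDiagram} {g : ℕ → ℕ → ℕ}

theorem mono (hg : IsGelfandTsetlin D g) (i : ℕ) : Monotone fun m => g m i :=
  monotone_nat_of_le_succ fun m => hg.mono_succ m i

theorem le_rowLen (hg : IsGelfandTsetlin D g) (m i : ℕ) : g m i ≤ D.rowLen i := by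
  obtain ⟨N, hN⟩ := hg.eventually
  rw [← hN (max m N) (le_max_right _ _) i]
  exact hg.mono i (le_max_left _ _)

theorem interlace_of_lt (hg : IsGelfandTsetlin D g) (m : ℕ) {i i' : ℕ} (h : i < i') :
    g (m + 1) i' ≤ g m i :=
  (antitone_nat_of_succ_le (f := fun i => g (m + 1) i)
    (fun i => (hg.interlace m i).trans (hg.mono_succ m i)) (Nat.succ_le_of_lt h)).trans
    (hg.interlace m i)

theorem exists_lt (hg : IsGelfandTsetlin D g) {i j : ℕ} (h : (i, j) ∈ D) :
    ∃ m, j < g (m + 1) i := by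
  obtain ⟨N, hN⟩ := hg.eventually
  exact ⟨N, by rw [hN _ (Nat.le_succ N)]; exact YoungDiagram.mem_iff_lt_rowLen.1 h⟩

open Classical in
/-- The entries of the tableau of a Gelfand-Tsetlin pattern. -/
noncomputable def entry (hg : IsGelfandTsetlin D g) (i j : ℕ) : ℕ :=
  -- `g (m + 1) i` counts the entries at most `m`, hence the shift; `0` outside `D` is the
  -- convention for tableaux.
  if h : (i, j) ∈ D then Nat.find (hg.exists_lt h) else 0

theorem entry_lt_iff (hg : IsGelfandTsetlin D g) {i j : ℕ} (h : (i, j) ∈ D) (m : ℕ) :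
    hg.entry i j < m ↔ j < g m i := by
  classical
  rw [entry, dif_pos h, Nat.find_lt_iff]
  constructor
  · rintro ⟨m', h1, h2⟩
    exact h2.trans_le (hg.mono i h1)
  · intro h1
    rcases m with _ | m
    · simp [hg.zero] at h1
    · exact ⟨m, Nat.lt_succ_self m, h1⟩

/-- The semistandard tableau of a Gelfand-Tsetlin pattern. -/
noncomputable def toTableau (hg : IsGelfandTsetlin D g) : SemistandardYoungTableau D where
  entry := hg.entry
  row_weak' {i j1 j2} hj h := by
    rw [← Nat.lt_succ_iff, hg.entry_lt_iff (D.up_left_mem le_rfl hj.le h)]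
    exact hj.trans ((hg.entry_lt_iff h _).1 (Nat.lt_succ_self _))
  col_strict' {i1 i2 j} hi h := by
    rw [hg.entry_lt_iff (D.up_left_mem hi.le le_rfl h)]
    exact ((hg.entry_lt_iff h _).1 (Nat.lt_succ_self _)).trans_le (hg.interlace_of_lt _ hi)
  zeros' h := dif_neg h

theorem toTableau_lt_iff (hg : IsGelfandTsetlin D g) {i j : ℕ} (h : (i, j) ∈ D) (m : ℕ) :
    hg.toTableau i j < m ↔ j < g m i :=
  hg.entry_lt_iff h m

end IsGelfandTsetlin

section Tableaux

variable {D : YoungDiagram}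

theorem exists_not_lt (T : SemistandardYoungTableau D) (m i : ℕ) :
    ∃ j, ¬((i, j) ∈ D ∧ T i j < m) :=
  (D.exists_notMem_row i).imp fun _ h h' => h h'.1

open Classical in
/-- The number of entries less than `m` in row `i` of a semistandard tableau. -/
noncomputable def rowCount (T : SemistandardYoungTableau D) (m i : ℕ) : ℕ :=
  Nat.find (exists_not_lt T m i)

/-- Rows increase weakly, so the entries less than `m` form an initial segment of the row. -/
theorem lt_rowCount_iff (T : SemistandardYoungTableau D) {m i j : ℕ} :
    j < rowCount T m i ↔ (i, j) ∈ D ∧ T i j < m := by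
  classical
  rw [rowCount, Nat.lt_find_iff]
  simp only [not_not]
  constructor
  · intro h
    exact h j le_rfl
  · rintro ⟨h1, h2⟩ j' hj
    exact ⟨D.up_left_mem le_rfl hj h1, (T.row_weak_of_le hj h1).trans_lt h2⟩

theorem isGelfandTsetlin_rowCount (T : SemistandardYoungTableau D) :
    IsGelfandTsetlin D (rowCount T) where
  zero i := by
    by_contra h
    exact absurd ((lt_rowCount_iff T).1 (Nat.pos_of_ne_zero h)).2 (Nat.not_lt_zero _)
  mono_succ m i := by
    refine le_of_forall_lt fun j hj => ?_
    rw [lt_rowCount_iff] at hj ⊢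
    exact ⟨hj.1, hj.2.trans (Nat.lt_succ_self m)⟩
  interlace m i := by
    refine le_of_forall_lt fun j hj => ?_
    rw [lt_rowCount_iff] at hj ⊢
    exact ⟨D.up_left_mem (Nat.le_succ i) le_rfl hj.1,
      (T.col_strict (Nat.lt_succ_self i) hj.1).trans_le (Nat.lt_succ_iff.1 hj.2)⟩
  eventually := by
    refine ⟨D.cells.sup (fun c => T c.1 c.2) + 1, fun m hm i => ?_⟩
    refine eq_of_forall_lt_iff fun j => ?_
    rw [lt_rowCount_iff, ← YoungDiagram.mem_iff_lt_rowLen, and_iff_left_iff_imp]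
    intro h
    exact (Nat.lt_succ_of_le (le_sup (f := fun c : ℕ × ℕ => T c.1 c.2)
      ((YoungDiagram.mem_cells _).2 h))).trans_le hm

/-- Semistandard tableaux correspond to Gelfand-Tsetlin patterns. -/
noncomputable def tableauEquivGelfandTsetlin (D : YoungDiagram) :
    SemistandardYoungTableau D ≃ {g : ℕ → ℕ → ℕ // IsGelfandTsetlin D g} where
  toFun T := ⟨rowCount T, isGelfandTsetlin_rowCount T⟩
  invFun g := g.2.toTableau
  left_inv T := by
    ext i j
    by_cases h : (i, j) ∈ D
    · refine eq_of_forall_gt_iff fun m => ?_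
      rw [IsGelfandTsetlin.toTableau_lt_iff _ h, lt_rowCount_iff, and_iff_right h]
    · rw [SemistandardYoungTableau.zeros _ h, SemistandardYoungTableau.zeros _ h]
  right_inv g := by
    ext m i
    refine eq_of_forall_lt_iff fun j => ?_
    rw [lt_rowCount_iff]
    constructor
    · rintro ⟨h1, h2⟩
      exact (g.2.toTableau_lt_iff h1 m).1 h2
    · intro h
      have h1 : (i, j) ∈ D := YoungDiagram.mem_iff_lt_rowLen.2 (h.trans_le (g.2.le_rowLen m i))
      exact ⟨h1, (g.2.toTableau_lt_iff h1 m).2 h⟩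

theorem card_filter_lt_eq_sum_rowCount (T : SemistandardYoungTableau D) (m : ℕ) :
    #{c ∈ D.cells | T c.1 c.2 < m} = ∑ i ∈ range (D.colLen 0), rowCount T m i := by
  classical
  rw [card_eq_sum_card_fiberwise (f := Prod.fst) (t := range (D.colLen 0))]
  · refine sum_congr rfl fun i _ => ?_
    rw [← card_range (rowCount T m i)]
    refine card_nbij' Prod.snd (fun j => (i, j)) ?_ ?_ ?_ ?_
    · rintro ⟨i', j⟩ h
      simp only [coe_filter, mem_filter, Set.mem_ofPred_eq, YoungDiagram.mem_cells,
        coe_range, Set.mem_Iio, lt_rowCount_iff] at h ⊢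
      obtain ⟨h1, rfl⟩ := h
      exact h1
    · intro j h
      simp only [coe_filter, mem_filter, Set.mem_ofPred_eq, YoungDiagram.mem_cells,
        coe_range, Set.mem_Iio, lt_rowCount_iff] at h ⊢
      tauto
    · rintro ⟨i', j⟩ h
      simp only [coe_filter, mem_filter, Set.mem_ofPred_eq] at h
      simp [h.2]
    · intro j _; rfl
  · rintro ⟨i, j⟩ h
    simp only [coe_filter, Set.mem_ofPred_eq, YoungDiagram.mem_cells] at h
    simpa using YoungDiagram.mem_iff_lt_colLen.1 (D.up_left_mem le_rfl (Nat.zero_le j) h.1)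

theorem card_filter_lt_succ (T : SemistandardYoungTableau D) (m : ℕ) :
    #{c ∈ D.cells | T c.1 c.2 < m + 1} =
      #{c ∈ D.cells | T c.1 c.2 < m} + #{c ∈ D.cells | T c.1 c.2 = m} := by
  rw [← card_union_of_disjoint, ← filter_or]
  · simp only [Nat.lt_succ_iff_lt_or_eq]
  · exact disjoint_filter.2 fun _ _ h1 h2 => h1.ne h2

/-- The content of a tableau in terms of its Gelfand-Tsetlin pattern. -/
theorem content_iff (T : SemistandardYoungTableau D) (d : ℕ → ℕ) :
    (∀ k, #{c ∈ D.cells | T c.1 c.2 = k} = d k) ↔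
      ∀ k, ∑ i ∈ range (D.colLen 0), rowCount T (k + 1) i =
        ∑ i ∈ range (D.colLen 0), rowCount T k i + d k := by
  simp only [← card_filter_lt_eq_sum_rowCount, card_filter_lt_succ, Nat.add_left_cancel_iff]

end Tableaux

section Reflection

/-- The least possible value at `(k + 1, i)` given the neighbouring levels of a pattern. -/
def lowerBound (g : ℕ → ℕ → ℕ) (k i : ℕ) : ℕ := max (g k i) (g (k + 2) (i + 1))

/-- The greatest possible value at `(k + 1, i)` given the neighbouring levels of a pattern. -/
def upperBound (g : ℕ → ℕ → ℕ) (k : ℕ) : ℕ → ℕ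
  | 0 => g (k + 2) 0
  | i + 1 => min (g (k + 2) (i + 1)) (g k i)

/-- Reflection of level `k + 1` of a Gelfand-Tsetlin pattern (the Bender-Knuth involution). -/
def reflect (k : ℕ) (g : ℕ → ℕ → ℕ) (m i : ℕ) : ℕ :=
  if m = k + 1 then lowerBound g k i + upperBound g k i - g (k + 1) i else g m i

theorem reflect_self (k : ℕ) (g : ℕ → ℕ → ℕ) (i : ℕ) :
    reflect k g (k + 1) i = lowerBound g k i + upperBound g k i - g (k + 1) i := if_pos rfl

theorem reflect_of_ne {k m : ℕ} (h : m ≠ k + 1) (g : ℕ → ℕ → ℕ) (i : ℕ) :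
    reflect k g m i = g m i := if_neg h

variable {D : YoungDiagram} {g : ℕ → ℕ → ℕ}

theorem IsGelfandTsetlin.lowerBound_le (hg : IsGelfandTsetlin D g) (k i : ℕ) :
    lowerBound g k i ≤ g (k + 1) i :=
  max_le (hg.mono_succ k i) (hg.interlace (k + 1) i)

theorem IsGelfandTsetlin.le_upperBound (hg : IsGelfandTsetlin D g) (k i : ℕ) :
    g (k + 1) i ≤ upperBound g k i := by
  cases i with
  | zero => exact hg.mono_succ (k + 1) 0
  | succ i => exact le_min (hg.mono_succ (k + 1) _) (hg.interlace k i)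

theorem upperBound_le (g : ℕ → ℕ → ℕ) (k i : ℕ) : upperBound g k i ≤ g (k + 2) i := by
  cases i with
  | zero => exact le_rfl
  | succ i => exact min_le_left _ _

/-- With levels `k` and `k + 2` fixed, the conditions on level `k + 1` say exactly that each value
lies between its two bounds, and reflection preserves that interval. The natural subtraction is
therefore never truncated. -/
theorem IsGelfandTsetlin.reflect (hg : IsGelfandTsetlin D g) (k : ℕ) :
    IsGelfandTsetlin D (reflect k g) where
  zero i := by rw [reflect_of_ne (by omega), hg.zero]
  mono_succ m i := by
    have h1 := hg.lowerBound_le k i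
    have h2 := hg.le_upperBound k i
    rcases eq_or_ne m k with rfl | hm
    · have h3 : g m i ≤ lowerBound g m i := le_max_left _ _
      rw [reflect_of_ne (by omega), reflect_self]
      omega
    rcases eq_or_ne m (k + 1) with rfl | hm'
    · have h3 := upperBound_le g k i
      rw [reflect_of_ne (m := k + 1 + 1) (by omega), reflect_self]
      change _ ≤ g (k + 2) i
      omega
    · rw [reflect_of_ne hm', reflect_of_ne (by omega)]
      exact hg.mono_succ m i
  interlace m i := by
    rcases eq_or_ne m k with rfl | hm
    · have h1 := hg.lowerBound_le m (i + 1)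
      have h2 := hg.le_upperBound m (i + 1)
      have h3 : upperBound g m (i + 1) ≤ g m i := min_le_right _ _
      rw [reflect_of_ne (m := m) (by omega), reflect_self]
      omega
    rcases eq_or_ne m (k + 1) with rfl | hm'
    · have h1 := hg.lowerBound_le k i
      have h2 := hg.le_upperBound k i
      have h3 : g (k + 2) (i + 1) ≤ lowerBound g k i := le_max_right _ _
      rw [reflect_of_ne (by omega), reflect_self]
      change g (k + 2) (i + 1) ≤ _
      omega
    · rw [reflect_of_ne hm', reflect_of_ne (by omega)]
      exact hg.interlace m i
  eventually := by
    obtain ⟨N, hN⟩ := hg.eventually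
    exact ⟨max N (k + 2), fun m hm i => by
      rw [reflect_of_ne (by have := le_max_right N (k + 2); omega), hN m (le_of_max_le_left hm)]⟩

theorem IsGelfandTsetlin.reflect_reflect (hg : IsGelfandTsetlin D g) (k : ℕ) :
    CycleCount.reflect k (CycleCount.reflect k g) = g := by
  have h1 : lowerBound (CycleCount.reflect k g) k = lowerBound g k := by
    ext i
    rw [lowerBound, lowerBound, reflect_of_ne (by omega), reflect_of_ne (by omega)]
  have h2 : upperBound (CycleCount.reflect k g) k = upperBound g k := by
    ext i
    cases i with
    | zero => rw [upperBound, upperBound, reflect_of_ne (by omega)]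
    | succ i => rw [upperBound, upperBound, reflect_of_ne (by omega), reflect_of_ne (by omega)]
  ext m i
  rcases eq_or_ne m (k + 1) with rfl | hm
  · have h3 := hg.lowerBound_le k i
    have h4 := hg.le_upperBound k i
    rw [reflect_self, reflect_self, h1, h2]
    omega
  · rw [reflect_of_ne hm, reflect_of_ne hm]

/-- The reflection of level `k + 1` as a permutation of the patterns. -/
def reflectEquiv (D : YoungDiagram) (k : ℕ) :
    Equiv.Perm {g : ℕ → ℕ → ℕ // IsGelfandTsetlin D g} where
  toFun g := ⟨reflect k g, g.2.reflect k⟩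
  invFun g := ⟨reflect k g, g.2.reflect k⟩
  left_inv g := Subtype.ext (g.2.reflect_reflect k)
  right_inv g := Subtype.ext (g.2.reflect_reflect k)

theorem sum_lowerBound_add_upperBound (g : ℕ → ℕ → ℕ) (k R : ℕ) :
    ∑ i ∈ range R, lowerBound g k i + ∑ i ∈ range (R + 1), upperBound g k i =
      ∑ i ∈ range R, g k i + ∑ i ∈ range (R + 1), g (k + 2) i := by
  rw [sum_range_succ', sum_range_succ', ← add_assoc, ← add_assoc, ← sum_add_distrib,
    ← sum_add_distrib]
  congr 1
  -- The lower bound at `i` and the upper bound at `i + 1` are the maximum and the minimum of the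
  -- same two numbers.
  refine sum_congr rfl fun i _ => ?_
  rw [lowerBound, upperBound, min_comm, max_add_min]

theorem IsGelfandTsetlin.sum_reflect (hg : IsGelfandTsetlin D g) (k : ℕ) :
    ∑ i ∈ range (D.colLen 0), CycleCount.reflect k g (k + 1) i +
        ∑ i ∈ range (D.colLen 0), g (k + 1) i =
      ∑ i ∈ range (D.colLen 0), g k i + ∑ i ∈ range (D.colLen 0), g (k + 2) i := by
  -- The first row past the diagram is empty, so the extra term of each longer sum vanishes.
  have hrow : D.rowLen (D.colLen 0) = 0 := by
    by_contra h
    have := YoungDiagram.mem_iff_lt_colLen.1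
      (YoungDiagram.mem_iff_lt_rowLen.2 (Nat.pos_of_ne_zero h))
    exact lt_irrefl _ this
  have h0 : g (k + 2) (D.colLen 0) = 0 := Nat.le_zero.1 ((hg.le_rowLen _ _).trans hrow.le)
  have h1 := sum_lowerBound_add_upperBound g k (D.colLen 0)
  rw [sum_range_succ _ (D.colLen 0), sum_range_succ _ (D.colLen 0), h0,
    Nat.le_zero.1 ((upperBound_le g k (D.colLen 0)).trans h0.le), add_zero, add_zero] at h1
  rw [← h1, ← sum_add_distrib, ← sum_add_distrib]
  refine sum_congr rfl fun i _ => ?_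
  have h3 := hg.lowerBound_le k i
  have h4 := hg.le_upperBound k i
  rw [reflect_self]
  omega

/-- Reflecting level `k + 1` exchanges the multiplicities of `k` and `k + 1`. -/
theorem IsGelfandTsetlin.content_reflect (hg : IsGelfandTsetlin D g) (k : ℕ) {d : ℕ → ℕ}
    (hd : ∀ m, ∑ i ∈ range (D.colLen 0), g (m + 1) i = ∑ i ∈ range (D.colLen 0), g m i + d m)
    (m : ℕ) :
    ∑ i ∈ range (D.colLen 0), CycleCount.reflect k g (m + 1) i =
      ∑ i ∈ range (D.colLen 0), CycleCount.reflect k g m i + d (Equiv.swap k (k + 1) m) := by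
  have hs := hg.sum_reflect k
  have h1 := hd k
  have h2 : ∑ i ∈ range (D.colLen 0), g (k + 2) i =
    ∑ i ∈ range (D.colLen 0), g (k + 1) i + d (k + 1) := hd (k + 1)
  have hne : ∀ {m}, m ≠ k + 1 → ∑ i ∈ range (D.colLen 0), CycleCount.reflect k g m i =
      ∑ i ∈ range (D.colLen 0), g m i := fun h => sum_congr rfl fun i _ => reflect_of_ne h g i
  rcases eq_or_ne m k with rfl | hm
  · rw [Equiv.swap_apply_left, hne (m := m) (by omega)]
    omega
  rcases eq_or_ne m (k + 1) with rfl | hm'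
  · rw [Equiv.swap_apply_right, hne (m := k + 1 + 1) (by omega)]
    change ∑ i ∈ range (D.colLen 0), g (k + 2) i = _
    omega
  · rw [Equiv.swap_apply_of_ne_of_ne hm hm', hne hm', hne (by omega)]
    exact hd m

end Reflection

theorem card_tableaux_swap (D : YoungDiagram) (k : ℕ) (d : ℕ → ℕ) :
    Nat.card {T : SemistandardYoungTableau D //
        ∀ m, #{c ∈ D.cells | T c.1 c.2 = m} = d (Equiv.swap k (k + 1) m)} =
      Nat.card {T : SemistandardYoungTableau D // ∀ m, #{c ∈ D.cells | T c.1 c.2 = m} = d m} := by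
  let e := tableauEquivGelfandTsetlin D
  let E : SemistandardYoungTableau D ≃ SemistandardYoungTableau D :=
    (e.trans (reflectEquiv D k)).trans e.symm
  have hE : ∀ T, rowCount (E T) = reflect k (rowCount T) := fun T =>
    congrArg Subtype.val (e.apply_symm_apply (reflectEquiv D k (e T)))
  have hEE : ∀ T, E (E T) = T := fun T => by
    apply e.injective
    apply Subtype.ext
    change rowCount (E (E T)) = rowCount T
    rw [hE, hE, (isGelfandTsetlin_rowCount T).reflect_reflect]
  have h : ∀ (T : SemistandardYoungTableau D) (d : ℕ → ℕ),
      (∀ m, #{c ∈ D.cells | T c.1 c.2 = m} = d m) →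
      ∀ m, #{c ∈ D.cells | E T c.1 c.2 = m} = d (Equiv.swap k (k + 1) m) := by
    intro T d hT
    refine (content_iff (E T) fun m => d (Equiv.swap k (k + 1) m)).2 ?_
    rw [hE]
    exact (isGelfandTsetlin_rowCount T).content_reflect k ((content_iff T d).1 hT)
  refine Nat.card_congr (E.subtypeEquiv fun T => ⟨fun hT m => ?_, fun hT => ?_⟩)
  · simpa using h T (fun m => d (Equiv.swap k (k + 1) m)) hT m
  · rw [← hEE T]
    exact h (E T) d hT

/-! ### The Schur functions form a basis of the symmetric functions -/

/-- Adjacent transpositions do not generate all permutations of `ℕ`, but they suffice on a finite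
set, and a monomial involves only finitely many variables. -/
theorem exists_mem_eqOn_of_swap_mem {H : Subgroup (Equiv.Perm ℕ)}
    (hH : ∀ k, Equiv.swap k (k + 1) ∈ H) (s : Finset ℕ) (e : Equiv.Perm ℕ) :
    ∃ e' ∈ H, ∀ x ∈ s, e' x = e x := by
  have hlt : ∀ i t, Equiv.swap i (i + t) ∈ H := by
    intro i t
    induction t with
    | zero => exact (Equiv.swap_self i).symm ▸ H.one_mem
    | succ t ih =>
      rcases Nat.eq_zero_or_pos t with rfl | ht
      · exact hH i
      · rw [← add_assoc, Equiv.swap_comm,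
          ← Equiv.swap_mul_swap_mul_swap (x := i) (y := i + t) (by omega) (by omega)]
        exact mul_mem (mul_mem (hH _) ih) (hH _)
  have hswap : ∀ i j, Equiv.swap i j ∈ H := by
    intro i j
    rcases le_total i j with h | h
    · obtain ⟨t, rfl⟩ := Nat.exists_eq_add_of_le h
      exact hlt i t
    · obtain ⟨t, rfl⟩ := Nat.exists_eq_add_of_le h
      rw [Equiv.swap_comm]
      exact hlt j t
  induction s using Finset.induction_on with
  | empty => exact ⟨1, H.one_mem, by simp⟩
  | insert a s ha ih =>
    obtain ⟨e', he', hs⟩ := ih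
    -- The transposition corrects the value at `a` and fixes the values already matched, by
    -- injectivity of `e'` and `e`.
    refine ⟨Equiv.swap (e' a) (e a) * e', mul_mem (hswap _ _) he', fun x hx => ?_⟩
    rcases mem_insert.1 hx with rfl | hx
    · simp
    · have hxa : x ≠ a := fun h => ha (h ▸ hx)
      rw [Equiv.Perm.mul_apply, Equiv.swap_apply_of_ne_of_ne (e'.injective.ne hxa), hs x hx]
      rw [hs x hx]
      exact e.injective.ne hxa

section

variable {K : Type*} [Field K] {n : ℕ}

theorem coeff_schurFunction (μ : n.Partition) (d : ℕ →₀ ℕ) :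
    MvPowerSeries.coeff d (schurFunction K μ) =
      (Nat.card {T : SemistandardYoungTableau (diagram μ) //
        ∀ k, #{c ∈ (diagram μ).cells | T c.1 c.2 = k} = d k} : K) := rfl

theorem coeff_mapDomain_schurFunction (μ : n.Partition) (e : Equiv.Perm ℕ) (d : ℕ →₀ ℕ) :
    MvPowerSeries.coeff (d.mapDomain e) (schurFunction K μ) =
      MvPowerSeries.coeff d (schurFunction K μ) := by
  -- The permutations of the variables that preserve `s_μ` form a subgroup; Bender-Knuth puts the
  -- adjacent transpositions in it.
  let H : Subgroup (Equiv.Perm ℕ) :=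
    { carrier := {e | ∀ d : ℕ →₀ ℕ, MvPowerSeries.coeff (d.mapDomain e) (schurFunction K μ) =
        MvPowerSeries.coeff d (schurFunction K μ)}
      one_mem' := fun d => by simp
      mul_mem' := fun {a b} ha hb d => by
        rw [Equiv.Perm.coe_mul, Finsupp.mapDomain_comp, ha, hb]
      inv_mem' := fun {a} ha d => by
        rw [← ha, ← Finsupp.mapDomain_comp, ← Equiv.Perm.coe_mul]
        simp }
  have hH : ∀ k, Equiv.swap k (k + 1) ∈ H := by
    intro k d
    rw [coeff_schurFunction, coeff_schurFunction]
    simp only [Finsupp.mapDomain_equiv_apply, Equiv.symm_swap]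
    rw [card_tableaux_swap (diagram μ) k d]
  obtain ⟨e', he', hs⟩ := exists_mem_eqOn_of_swap_mem hH d.support e
  rw [← he' d, Finsupp.mapDomain_congr hs]

theorem degree_eq_of_content {D : YoungDiagram} {T : ℕ × ℕ → ℕ} {d : ℕ →₀ ℕ}
    (h : ∀ k, #{c ∈ D.cells | T c = k} = d k) : d.degree = #D.cells := by
  rw [Finsupp.degree_apply, card_eq_sum_card_fiberwise (f := T) (t := d.support)]
  · exact sum_congr rfl fun k _ => (h k).symm
  · intro c hc
    rw [mem_coe, Finsupp.mem_support_iff, ← h]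
    exact card_ne_zero_of_mem (mem_filter.2 ⟨hc, rfl⟩)

theorem schurFunction_mem (μ : n.Partition) : schurFunction K μ ∈ SymmetricFunctions K n := by
  refine ⟨fun d hd => ?_, coeff_mapDomain_schurFunction μ⟩
  rw [coeff_schurFunction, Nat.card_eq_zero.2 (Or.inl ⟨fun T => hd ?_⟩), Nat.cast_zero]
  rw [degree_eq_of_content (T := fun c => T.1 c.1 c.2) T.2, card_diagram]

/-- The exponent vector `(μ₁, μ₂, …)` of a partition. -/
noncomputable def rowContent (μ : n.Partition) : ℕ →₀ ℕ :=
  Finsupp.onFinset (range ((diagram μ).colLen 0)) (diagram μ).rowLen fun i hi => by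
    rw [mem_range, ← YoungDiagram.mem_iff_lt_colLen, YoungDiagram.mem_iff_lt_rowLen]
    exact Nat.pos_of_ne_zero hi

theorem rowContent_apply (μ : n.Partition) (i : ℕ) :
    rowContent μ i = (diagram μ).rowLen i := rfl

/-- All entries lie in the support of `d`. Finiteness matters because `Nat.card` of an infinite type
is `0`. -/
theorem finite_tableaux (D : YoungDiagram) (d : ℕ →₀ ℕ) :
    Finite {T : SemistandardYoungTableau D // ∀ k, #{c ∈ D.cells | T c.1 c.2 = k} = d k} := by
  have hmem : ∀ (T : {T : SemistandardYoungTableau D //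
      ∀ k, #{c ∈ D.cells | T c.1 c.2 = k} = d k}) (c : D.cells), T.1 c.1.1 c.1.2 ∈ d.support := by
    intro T c
    rw [Finsupp.mem_support_iff, ← T.2]
    exact card_ne_zero_of_mem (mem_filter.2 ⟨c.2, rfl⟩)
  refine Finite.of_injective (fun T => fun c : D.cells => (⟨_, hmem T c⟩ : d.support)) ?_
  intro T T' h
  ext i j
  by_cases hc : (i, j) ∈ D
  · exact congrArg Subtype.val (congrFun h ⟨(i, j), (YoungDiagram.mem_cells _).2 hc⟩)
  · rw [T.1.zeros hc, T'.1.zeros hc]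

theorem coeff_rowContent_schurFunction_self [CharZero K] (μ : n.Partition) :
    MvPowerSeries.coeff (rowContent μ) (schurFunction K μ) ≠ 0 := by
  rw [coeff_schurFunction, Nat.cast_ne_zero, Nat.card_ne_zero]
  -- The tableau with every entry of row `i` equal to `i` has this content.
  refine ⟨⟨⟨SemistandardYoungTableau.highestWeight _, fun k => ?_⟩⟩, finite_tableaux _ _⟩
  rw [rowContent_apply, YoungDiagram.rowLen_eq_card]
  congr 1
  ext ⟨i, j⟩
  rw [mem_filter, YoungDiagram.mem_cells, SemistandardYoungTableau.highestWeight_apply,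
    YoungDiagram.mem_row_iff]
  refine and_congr_right fun h => ?_
  rw [if_pos h]

/-- A tableau of shape `μ` and content `l` is injective on columns, and its entries less than `k`
number `l₁ + … + l_k`. -/
theorem cellsAbove_le_of_coeff_ne_zero {l μ : n.Partition}
    (h : MvPowerSeries.coeff (rowContent l) (schurFunction K μ) ≠ 0) (k : ℕ) :
    cellsAbove (diagram l) k ≤ cellsAbove (diagram μ) k := by
  rw [coeff_schurFunction] at h
  obtain ⟨⟨T, hT⟩⟩ := (Nat.card_ne_zero.1 fun h0 => h (by rw [h0, Nat.cast_zero])).1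
  have h2 : ∀ k, #{c ∈ (diagram μ).cells | T c.1 c.2 < k} = cellsAbove (diagram l) k := by
    intro k
    induction k with
    | zero => simp [cellsAbove]
    | succ k ih => rw [card_filter_lt_succ, ih, hT, cellsAbove_succ, rowContent_apply]
  rw [← h2]
  refine card_filter_lt_le_cellsAbove _ (fun c => T c.1 c.2) ?_ k
  rintro ⟨i, j⟩ hc ⟨i', j'⟩ hc' h1 h2
  obtain rfl : j = j' := h1
  rw [YoungDiagram.mem_cells] at hc hc'
  rcases lt_trichotomy i i' with h | rfl | h
  · exact absurd h2 (T.col_strict h hc').ne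
  · rfl
  · exact absurd h2 (T.col_strict h hc).ne'

/-- The Schur function as an element of `Λ_n`. -/
noncomputable def schur (K : Type*) [Field K] {n : ℕ} (μ : n.Partition) : SymmetricFunctions K n :=
  ⟨schurFunction K μ, schurFunction_mem μ⟩

theorem linearIndependent_schur [CharZero K] :
    LinearIndependent K (fun μ : n.Partition => schur K μ) := by
  refine linearIndependent_of_triangular (fun μ : n.Partition => cellsAbove (diagram μ))
    (fun l => MvPowerSeries.coeff (rowContent l) ∘ₗ (SymmetricFunctions K n).subtype) _
    (fun l => coeff_rowContent_schurFunction_self l) (fun l μ h => ?_)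
  exact eq_or_lt_of_cellsAbove_le (cellsAbove_le_of_coeff_ne_zero h)

theorem map_support_single_add {a b : ℕ} {f : ℕ →₀ ℕ} (ha : a ∉ f.support) (hb : b ≠ 0) :
    (Finsupp.single a b + f).support.val.map (Finsupp.single a b + f) =
      b ::ₘ f.support.val.map f := by
  rw [Finsupp.support_single_add ha hb, cons_val, Multiset.map_cons]
  congr 1
  · simpa using Finsupp.notMem_support_iff.1 ha
  · refine Multiset.map_congr rfl fun x hx => ?_
    have hxa : a ≠ x := fun h => ha (h ▸ hx)
    simp [hxa]

theorem exists_mapDomain_eq {d d' : ℕ →₀ ℕ}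
    (h : d.support.val.map d = d'.support.val.map d') :
    ∃ e : Equiv.Perm ℕ, d.mapDomain e = d' := by
  induction d using Finsupp.induction generalizing d' with
  | zero =>
    refine ⟨1, ?_⟩
    have h1 : d'.support.val = 0 := by simpa using h.symm
    rw [Finset.val_eq_zero, Finsupp.support_eq_empty] at h1
    simp [h1]
  | single_add a b f ha hb ih =>
    rw [map_support_single_add ha hb] at h
    obtain ⟨a', -, hb'⟩ := Multiset.mem_map.1 (h ▸ Multiset.mem_cons_self b _)
    have hd' : d' = Finsupp.single a' b + d'.erase a' := by
      rw [← hb', Finsupp.single_add_erase]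
    have ha' : a' ∉ (d'.erase a').support := by simp
    rw [hd', map_support_single_add ha' hb, Multiset.cons_inj_right] at h
    obtain ⟨e, he⟩ := ih h
    -- The swap moves the value `b` to `a'` and leaves the rest alone, since `d'.erase a'` vanishes
    -- at both swapped positions.
    refine ⟨e.trans (Equiv.swap (e a) a'), ?_⟩
    have h1 : d'.erase a' (e a) = 0 := by
      rw [← he, Finsupp.mapDomain_apply e.injective]
      exact Finsupp.notMem_support_iff.1 ha
    have h2 : (d'.erase a').mapDomain (Equiv.swap (e a) a') = d'.erase a' := by
      ext x
      rw [Finsupp.mapDomain_equiv_apply, Equiv.symm_swap, Equiv.swap_apply_def]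
      split_ifs with hx hx
      · rw [hx, h1, Finsupp.erase_same]
      · rw [hx, h1, Finsupp.erase_same]
      · rfl
    rw [Equiv.coe_trans, Finsupp.mapDomain_comp, Finsupp.mapDomain_add, he, Finsupp.mapDomain_add,
      h2, Finsupp.mapDomain_single, Finsupp.mapDomain_single, Equiv.swap_apply_left, ← hd']

theorem map_support_rowContent (μ : n.Partition) :
    (rowContent μ).support.val.map (rowContent μ) = μ.parts := by
  have h1 : (rowContent μ).support = range ((diagram μ).colLen 0) := by
    ext i
    rw [Finsupp.mem_support_iff, rowContent_apply, mem_range, ← YoungDiagram.mem_iff_lt_colLen,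
      YoungDiagram.mem_iff_lt_rowLen, Nat.pos_iff_ne_zero]
  have h2 : ((diagram μ).rowLens : Multiset ℕ) = μ.parts := by
    rw [rowLens_diagram]
    exact Multiset.sort_eq _ _
  rw [h1, ← h2]
  rfl

theorem exists_mapDomain_rowContent_eq {d : ℕ →₀ ℕ} (hd : d.degree = n) :
    ∃ (μ : n.Partition) (e : Equiv.Perm ℕ), (rowContent μ).mapDomain e = d := by
  let μ : n.Partition := ⟨d.support.val.map d, by
    intro i hi
    obtain ⟨x, hx, rfl⟩ := Multiset.mem_map.1 hi
    exact Nat.pos_of_ne_zero (Finsupp.mem_support_iff.1 hx), hd⟩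
  exact ⟨μ, exists_mapDomain_eq (map_support_rowContent μ)⟩

/-- The coefficients of a symmetric function at the exponent vectors of the partitions. -/
noncomputable def partitionCoeffs (K : Type*) [Field K] (n : ℕ) :
    SymmetricFunctions K n →ₗ[K] (n.Partition → K) :=
  LinearMap.pi fun l => MvPowerSeries.coeff (rowContent l) ∘ₗ (SymmetricFunctions K n).subtype

theorem partitionCoeffs_injective : Function.Injective (partitionCoeffs K n) := fun f g h => by
  ext d
  by_cases hd : d.degree = n
  · obtain ⟨μ, e, rfl⟩ := exists_mapDomain_rowContent_eq hd
    rw [f.2.2, g.2.2]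
    exact congrFun h μ
  · rw [f.2.1 d hd, g.2.1 d hd]

end

/-! ### The three bases and the characteristic map -/

theorem isCharacteristicMap_iff {K : Type*} [Field K] {n : ℕ}
    (ch : ClassFunctions K n →ₗ[K] SymmetricFunctions K n) :
    IsCharacteristicMap ch ↔ ∀ μ : n.Partition, ch (irrChar K μ) = schur K μ :=
  forall_congr' fun μ => (Subtype.ext_iff (a1 := ch (irrChar K μ)) (a2 := schur K μ)).symm

theorem exists_basis_irrChar (K : Type*) [Field K] [CharZero K] (n : ℕ) :
    ∃ b : Module.Basis n.Partition K (ClassFunctions K n), ∀ μ, b μ = irrChar K μ :=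
  exists_basis_of_linearIndependent (v := fun μ => irrChar K μ) linearIndependent_irrChar
    (classValues K n) classValues_injective

theorem exists_basis_cycleCount (K : Type*) [Field K] [CharZero K] (n : ℕ) :
    ∃ b : Module.Basis n.Partition K (ClassFunctions K n), ∀ μ, b μ = cycleCount K μ :=
  exists_basis_of_linearIndependent (v := fun μ => cycleCount K μ) linearIndependent_cycleCount
    (classValues K n) classValues_injective

theorem exists_basis_schur (K : Type*) [Field K] [CharZero K] (n : ℕ) :
    ∃ b : Module.Basis n.Partition K (SymmetricFunctions K n), ∀ μ, b μ = schur K μ :=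
  exists_basis_of_linearIndependent (v := fun μ => schur K μ) linearIndependent_schur
    (partitionCoeffs K n) partitionCoeffs_injective

end CycleCount

/-- The characteristic map is well defined (it exists and is unique), and it maps the family
of the cycle-counting functions, indexed by the partitions of `n`, to a basis of `Λ_n`. -/
theorem corollary7p7 (K : Type*) [Field K] [CharZero K] (n : ℕ) :
    (∃! ch : CycleCount.ClassFunctions K n →ₗ[K] CycleCount.SymmetricFunctions K n,
      CycleCount.IsCharacteristicMap ch) ∧
    ∀ ch : CycleCount.ClassFunctions K n →ₗ[K] CycleCount.SymmetricFunctions K n,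
      CycleCount.IsCharacteristicMap ch →
      ∃ b : Module.Basis n.Partition K (CycleCount.SymmetricFunctions K n),
        ∀ μ : n.Partition, b μ = ch (CycleCount.cycleCount K μ) := by
  obtain ⟨bχ, hχ⟩ := CycleCount.exists_basis_irrChar K n
  obtain ⟨bm, hm⟩ := CycleCount.exists_basis_cycleCount K n
  obtain ⟨bs, hs⟩ := CycleCount.exists_basis_schur K n
  -- Values on the basis of characters determine a linear map, so the only characteristic map is the
  -- equivalence between the two bases.
  have hiff : ∀ ch : CycleCount.ClassFunctions K n →ₗ[K] CycleCount.SymmetricFunctions K n,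
      CycleCount.IsCharacteristicMap ch ↔ ch = bχ.equiv bs (Equiv.refl _) := by
    intro ch
    rw [CycleCount.isCharacteristicMap_iff]
    constructor
    · intro h
      refine bχ.ext fun μ => ?_
      rw [hχ, h, LinearEquiv.coe_coe, ← hχ, Module.Basis.equiv_apply, Equiv.refl_apply, hs]
    · rintro rfl μ
      rw [LinearEquiv.coe_coe, ← hχ, Module.Basis.equiv_apply, Equiv.refl_apply, hs]
  refine ⟨⟨_, (hiff _).2 rfl, fun ch h => (hiff ch).1 h⟩, fun ch h => ?_⟩
  refine ⟨bm.map (bχ.equiv bs (Equiv.refl _)), fun μ => ?_⟩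
  rw [Module.Basis.map_apply, hm, (hiff ch).1 h, LinearEquiv.coe_coe]
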